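/- Let $A$ be a finite alphabet and let $X\subset A^{\mathbb Z}$ be a subshift of finite type (the set of all bi-infinite sequences in which no word from some fixed finite set of words appears), with left shift $(\sigma x)_n=x_{n+1}$. Assume that $X$ is transitive: for any two words $u,v$ appearing in points of $X$ there is a (possibly empty) word $w$ such that $uwv$ appears in a point of $X$. Let $r\colon X\to(0,\infty)$ satisfy the Walters property: for every $\varepsilon>0$ there is $k\ge 0$ such that for all $n\in\mathbb N$ and $x,y\in X$ with $x_i=y_i$ for $-k\le i\le n+k$, $$\Big|\sum_{j=0}^{n-1}\big(r(\sigma^jx)-r(\sigma^jy)\big)\Big|<\varepsilon .$$ Let $M_r=\{(x,t)\in X\times[0,\infty): 0\le t\le r(x)\}/{\sim}$, where $\sim$ is the equivalence relation generated by $(x,r(x))\sim(\sigma x,0)$, with the quotient topology, and let $\varphi^t\colon M_r\to M_r$ be the suspension flow: for $T\ge 0$, $\varphi^T(x,s)=(\sigma^nx,s')$, where $n\ge 0$ and $0\le s'\le r(\sigma^nx)$ satisfy $\sum_{j=0}^{n-1}r(\sigma^jx)+s'=T+s$, and $\varphi^{-T}=(\varphi^T)^{-1}$. Suppose that $\varphi^t$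 is not topologically mixing, where topologically mixing means that for all nonempty open $U,V\subset M_r$ there is $T\in\mathbb R$ with $\varphi^t(U)\cap V\neq\emptyset$ for all $t\ge T$. Then there exist $\delta>0$, a locally constant function $s\colon X\to(0,\infty)$ with values in $\delta\mathbb N$, and a continuous function $g\colon X\to\mathbb R$ such that $$r(x)-s(x)=g(\sigma x)-g(x)\qquad\text{for all }x\in X .$$ -/

import Mathlib

open Topology

namespace SuspensionMixing

open SymbolicDynamics.FullShift

/-! ### Topological mixing of flows and cohomology of roof functions -/

/-- A continuous time dynamical system `φ` is topologically mixing if for all nonempty open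
sets `U`, `V` there is `T` such that `φ^t(U) ∩ V ≠ ∅` for all `t ≥ T`. -/
def IsTopologicallyMixing {M : Type*} [TopologicalSpace M] (φ : ℝ → M → M) : Prop :=
  ∀ U V : Set M, IsOpen U → U.Nonempty → IsOpen V → V.Nonempty →
    ∃ T : ℝ, ∀ t : ℝ, T ≤ t → (φ t '' U ∩ V).Nonempty

/-- `r` and `s` are cohomologous over `f`: `r - s = g ∘ f - g` for some continuous real-valued
transfer function `g`. -/
def Cohomologous {X : Type*} [TopologicalSpace X] (f : X → X) (r s : X → ℝ) : Prop :=
  ∃ g : X → ℝ, Continuous g ∧ ∀ x, r x - s x = g (f x) - g x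

/-! ### Suspension flows -/

section Suspension

variable {X : Type*} (f : X → X) (r : X → ℝ)

/-- The region `{(x, t) : 0 ≤ t ≤ r x}` under the graph of the roof function. -/
abbrev RoofRegion : Type _ := {p : X × ℝ // 0 ≤ p.2 ∧ p.2 ≤ r p.1}

/-- The gluing `(x, r x) ∼ (f x, 0)`. -/
def RoofGlue (a b : RoofRegion r) : Prop :=
  a.1.2 = r a.1.1 ∧ b.1.1 = f a.1.1 ∧ b.1.2 = 0

/-- The phase space `M_r`: the quotient of the roof region by the equivalence relation generated
by `(x, r x) ∼ (f x, 0)`. -/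
def SuspensionSpace : Type _ := Quot (RoofGlue f r)

/-- The quotient topology. -/
instance [TopologicalSpace X] : TopologicalSpace (SuspensionSpace f r) :=
  inferInstanceAs (TopologicalSpace (Quot (RoofGlue f r)))

/-- The class of `(x, s)` in the phase space. -/
def SuspensionSpace.mk (a : RoofRegion r) : SuspensionSpace f r := Quot.mk _ a

/-- `q` is reached from `p` after flowing vertically for the time `T`: `p = (x, s)` and
`q = (f^n x, s')` with `∑_{j<n} r (f^j x) + s' = T + s`. -/
def FlowsForward (T : ℝ) (p q : SuspensionSpace f r) : Prop :=
  ∃ (a b : RoofRegion r) (n : ℕ), SuspensionSpace.mk f r a = p ∧ SuspensionSpace.mk f r b = q ∧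
    b.1.1 = f^[n] a.1.1 ∧ birkhoffSum f r n a.1.1 + b.1.2 = T + a.1.2

/-- The graph of the time-`T` map of the suspension flow, for `T` of either sign
(the time-`T` map with `T < 0` is the inverse of the time-`(-T)` map). -/
def FlowsTo (T : ℝ) (p q : SuspensionSpace f r) : Prop :=
  (0 ≤ T ∧ FlowsForward f r T p q) ∨ (T < 0 ∧ FlowsForward f r (-T) q p)

/-- The suspension flow of `f` with roof function `r`: `suspensionFlow f r T p` is the point `q`
with `FlowsTo f r T p q`. This point exists and is unique when `f` is bijective and `r` is bounded
below by a positive constant, see `suspensionFlow_eq_iff`. -/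
noncomputable def suspensionFlow (T : ℝ) (p : SuspensionSpace f r) : SuspensionSpace f r :=
  @Classical.epsilon _ ⟨p⟩ (FlowsTo f r T p)

/-- Two points of `X × ℝ` on the same orbit of `(x, t) ↦ (f x, t - r x)`. -/
def SameFibre (a b : X × ℝ) : Prop :=
  ∃ m n : ℕ, f^[m] a.1 = f^[n] b.1 ∧
    a.2 - birkhoffSum f r m a.1 = b.2 - birkhoffSum f r n b.1

variable {f r}

theorem SameFibre.refl (a : X × ℝ) : SameFibre f r a a := ⟨0, 0, rfl, rfl⟩

theorem SameFibre.symm {a b : X × ℝ} (h : SameFibre f r a b) : SameFibre f r b a := by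
  obtain ⟨m, n, h1, h2⟩ := h
  exact ⟨n, m, h1.symm, h2.symm⟩

theorem SameFibre.trans {a b c : X × ℝ} (h : SameFibre f r a b) (h' : SameFibre f r b c) :
    SameFibre f r a c := by
  obtain ⟨m, n, h1, h2⟩ := h
  obtain ⟨p, q, h3, h4⟩ := h'
  refine ⟨m + p, q + n, ?_, ?_⟩
  · rw [add_comm m p, Function.iterate_add_apply, h1, ← Function.iterate_add_apply,
      add_comm p n, Function.iterate_add_apply, h3, ← Function.iterate_add_apply, add_comm n q]
  · have e1 := birkhoffSum_add f r n p b.1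
    have e2 := birkhoffSum_add f r p n b.1
    rw [add_comm n p, e2] at e1
    rw [birkhoffSum_add, birkhoffSum_add, h1, ← h3]
    linarith

theorem sameFibre_of_mk_eq {a b : RoofRegion r}
    (h : SuspensionSpace.mk f r a = SuspensionSpace.mk f r b) : SameFibre f r a.1 b.1 := by
  have h' : Relation.EqvGen (RoofGlue f r) a b := Quot.eqvGen_exact h
  induction h' with
  | rel a b hab =>
    obtain ⟨h1, h2, h3⟩ := hab
    exact ⟨1, 0, by simp [h2], by simp [h1, h3, birkhoffSum_one]⟩
  | refl a => exact SameFibre.refl _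
  | symm a b _ ih => exact (ih (by exact (Quot.eqvGen_sound ‹_›))).symm
  | trans a b c _ _ ih1 ih2 =>
    exact (ih1 (by exact (Quot.eqvGen_sound ‹_›))).trans (ih2 (by exact (Quot.eqvGen_sound ‹_›)))

theorem mk_eq_of_iterate (hr : ∀ x, 0 < r x) {a b : RoofRegion r} (k : ℕ)
    (h1 : a.1.1 = f^[k] b.1.1) (h2 : a.1.2 = b.1.2 - birkhoffSum f r k b.1.1) :
    SuspensionSpace.mk f r a = SuspensionSpace.mk f r b := by
  obtain ⟨⟨x, s⟩, hs0, hs1⟩ := a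
  obtain ⟨⟨y, u⟩, hu0, hu1⟩ := b
  simp only at h1 h2 hs0 hs1 hu0 hu1
  rcases k with _ | _ | k
  · simp only [Function.iterate_zero, id_eq, birkhoffSum_zero, sub_zero] at h1 h2
    subst h1 h2
    rfl
  · simp only [zero_add, Function.iterate_one, birkhoffSum_one] at h1 h2
    refine (Quot.sound ?_).symm
    exact ⟨by simp only; linarith, h1, by simp only; linarith⟩
  · exfalso
    rw [birkhoffSum_succ', birkhoffSum_succ'] at h2
    have h3 : 0 ≤ birkhoffSum f r k (f (f y)) :=
      Finset.sum_nonneg fun i _ => (hr _).le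
    have := hr (f y)
    linarith

theorem mk_eq_of_sameFibre (hf : Function.Injective f) (hr : ∀ x, 0 < r x) {a b : RoofRegion r}
    (h : SameFibre f r a.1 b.1) : SuspensionSpace.mk f r a = SuspensionSpace.mk f r b := by
  have key : ∀ (a b : RoofRegion r) (m n : ℕ), m ≤ n → f^[m] a.1.1 = f^[n] b.1.1 →
      a.1.2 - birkhoffSum f r m a.1.1 = b.1.2 - birkhoffSum f r n b.1.1 →
      SuspensionSpace.mk f r a = SuspensionSpace.mk f r b := by
    intro a b m n hmn h1 h2
    obtain ⟨k, rfl⟩ := Nat.exists_eq_add_of_le hmn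
    rw [Function.iterate_add_apply] at h1
    have h3 : a.1.1 = f^[k] b.1.1 := hf.iterate m h1
    refine mk_eq_of_iterate hr k h3 ?_
    rw [add_comm m k, birkhoffSum_add, ← h3] at h2
    linarith
  obtain ⟨m, n, h1, h2⟩ := h
  rcases le_total m n with hmn | hmn
  · exact key a b m n hmn h1 h2
  · exact (key b a n m hmn h1.symm h2.symm).symm

theorem FlowsForward.sameFibre {T : ℝ} {a b : RoofRegion r}
    (h : FlowsForward f r T (SuspensionSpace.mk f r a) (SuspensionSpace.mk f r b)) :
    SameFibre f r (a.1.1, T + a.1.2) b.1 := by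
  obtain ⟨a', b', n, ha, hb, h1, h2⟩ := h
  obtain ⟨k, l, h3, h4⟩ := sameFibre_of_mk_eq ha
  have hA : SameFibre f r (a.1.1, T + a.1.2) (a'.1.1, T + a'.1.2) :=
    ⟨l, k, h3.symm, by simp only; linarith⟩
  have hB : SameFibre f r (a'.1.1, T + a'.1.2) b'.1 :=
    ⟨n, 0, by simp [h1], by simp only [birkhoffSum_zero]; linarith⟩
  exact hA.trans (hB.trans (sameFibre_of_mk_eq hb))

theorem flowsTo_sameFibre {T : ℝ} {a b : RoofRegion r}
    (h : FlowsTo f r T (SuspensionSpace.mk f r a) (SuspensionSpace.mk f r b)) :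
    SameFibre f r (a.1.1, T + a.1.2) b.1 := by
  rcases h with ⟨_, h⟩ | ⟨_, h⟩
  · exact h.sameFibre
  · obtain ⟨m, n, h1, h2⟩ := h.sameFibre
    exact ⟨n, m, h1.symm, by simp only at h2 ⊢; linarith⟩

theorem le_birkhoffSum {c : ℝ} (hc : ∀ x, c ≤ r x) (n : ℕ) (x : X) :
    n * c ≤ birkhoffSum f r n x := by
  have := Finset.card_nsmul_le_sum (Finset.range n) (fun k => r (f^[k] x)) c fun k _ => hc _
  simpa [birkhoffSum] using this

theorem exists_flowsTo (hf : Function.Surjective f) {c : ℝ} (hc0 : 0 < c) (hc : ∀ x, c ≤ r x)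
    (T : ℝ) (p : SuspensionSpace f r) : ∃ q, FlowsTo f r T p q := by
  classical
  obtain ⟨a, rfl⟩ : ∃ a, SuspensionSpace.mk f r a = p := Quot.exists_rep p
  obtain ⟨⟨x, s⟩, hs0, hs1⟩ := a
  simp only at hs0 hs1
  rcases le_or_gt 0 T with hT | hT
  · have hex : ∃ n : ℕ, T + s < birkhoffSum f r (n + 1) x := by
      obtain ⟨n, hn⟩ := exists_nat_gt ((T + s) / c)
      rw [div_lt_iff₀ hc0] at hn
      refine ⟨n, ?_⟩
      have := le_birkhoffSum (f := f) hc (n + 1) x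
      push_cast at this
      nlinarith
    have h1 := Nat.find_spec hex
    have h0 : birkhoffSum f r (Nat.find hex) x ≤ T + s := by
      rcases hn : Nat.find hex with _ | k
      · rw [birkhoffSum_zero]; linarith
      · exact not_lt.mp (Nat.find_min hex (m := k) (by omega))
    rw [birkhoffSum_succ] at h1
    refine ⟨SuspensionSpace.mk f r ⟨(f^[Nat.find hex] x, T + s - birkhoffSum f r (Nat.find hex) x),
      by simp only; linarith, by simp only; linarith⟩, Or.inl ⟨hT, _, _, Nat.find hex, rfl, rfl, rfl, ?_⟩⟩
    simp only
    ring
  · obtain ⟨g, hg⟩ := hf.hasRightInverse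
    have hgn : ∀ n, f^[n] (g^[n] x) = x := fun n => (hg.iterate n) x
    have hex : ∃ n : ℕ, -T ≤ birkhoffSum f r n (g^[n] x) + s := by
      obtain ⟨n, hn⟩ := exists_nat_gt (-T / c)
      rw [div_lt_iff₀ hc0] at hn
      refine ⟨n, ?_⟩
      have := le_birkhoffSum (f := f) hc n (g^[n] x)
      linarith
    have h1 := Nat.find_spec hex
    have h0 : birkhoffSum f r (Nat.find hex) (g^[Nat.find hex] x) + s + T
        ≤ r (g^[Nat.find hex] x) := by
      rcases hn : Nat.find hex with _ | k
      · simp only [birkhoffSum_zero, Function.iterate_zero, id_eq]; linarith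
      · have := not_le.mp (Nat.find_min hex (m := k) (by omega))
        rw [birkhoffSum_succ', Function.iterate_succ_apply', hg]
        linarith
    refine ⟨SuspensionSpace.mk f r ⟨(g^[Nat.find hex] x,
      birkhoffSum f r (Nat.find hex) (g^[Nat.find hex] x) + s + T),
      by simp only; linarith, h0⟩, Or.inr ⟨hT, _, _, Nat.find hex, rfl, rfl, (hgn _).symm, ?_⟩⟩
    simp only
    ring

/-- The suspension flow is well defined: its time-`T` map has the graph `FlowsTo f r T`. -/
theorem suspensionFlow_eq_iff (hf : Function.Bijective f) {c : ℝ} (hc0 : 0 < c)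
    (hc : ∀ x, c ≤ r x) (T : ℝ) (p q : SuspensionSpace f r) :
    suspensionFlow f r T p = q ↔ FlowsTo f r T p q := by
  have hspec : FlowsTo f r T p (suspensionFlow f r T p) :=
    Classical.epsilon_spec (exists_flowsTo hf.2 hc0 hc T p)
  refine ⟨fun h => h ▸ hspec, fun h => ?_⟩
  generalize suspensionFlow f r T p = q' at hspec
  obtain ⟨a, rfl⟩ : ∃ a, SuspensionSpace.mk f r a = p := Quot.exists_rep p
  obtain ⟨b, rfl⟩ : ∃ b, SuspensionSpace.mk f r b = q := Quot.exists_rep q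
  obtain ⟨b', rfl⟩ : ∃ b, SuspensionSpace.mk f r b = q' := Quot.exists_rep q'
  exact mk_eq_of_sameFibre hf.1 (fun x => hc0.trans_le (hc x))
    ((flowsTo_sameFibre hspec).symm.trans (flowsTo_sameFibre h))

end Suspension

/-! ### Two-sided shift spaces

A two-sided shift space over the alphabet `A` (with the discrete topology) is a
`Subshift A ℤ`: a closed shift-invariant subset of `ℤ → A` with the product topology. -/

section Shift

variable {A : Type*}

/-- The word `w` appears in `x` at position `i`. -/
def AppearsAt (w : List A) (x : ℤ → A) (i : ℤ) : Prop :=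
  ∀ (j : ℕ) (hj : j < w.length), x (i + j) = w[j]

variable [TopologicalSpace A]

/-- The language of a shift space: all words, including the empty one, that appear in some point. -/
def language (X : Subshift A ℤ) : Set (List A) :=
  {w | ∃ x ∈ X.carrier, ∃ i : ℤ, AppearsAt w x i}

/-- `X` is transitive: any two words of the language can be joined within the language. -/
def IsTransitive (X : Subshift A ℤ) : Prop :=
  ∀ u ∈ language X, ∀ v ∈ language X, ∃ w ∈ language X, u ++ w ++ v ∈ language X

/-- `X` is of finite type: it consists of all sequences avoiding a finite set of words. -/
def IsOfFiniteType (X : Subshift A ℤ) : Prop :=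
  ∃ F : Finset (List A), ∀ x : ℤ → A, x ∈ X.carrier ↔ ∀ w ∈ F, ∀ i : ℤ, ¬ AppearsAt w x i

/-- The left shift `(σ x)_n = x_{n+1}` on a shift space. -/
def leftShift (X : Subshift A ℤ) (x : X.carrier) : X.carrier :=
  ⟨fun n => x.1 (n + 1), by
    have h := X.mapsTo 1 x.2
    have e : shift (1 : ℤ) x.1 = fun n => x.1 (n + 1) := by
      funext n
      simp [add_comm]
    rwa [e] at h⟩

/-- The Walters property: for every `ε > 0` there is `k` such that the Birkhoff sums of length `n`
of `r` at `x` and `y` are `ε`-close whenever `x_{[-k, n+k]} = y_{[-k, n+k]}`. -/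
def WaltersProperty (X : Subshift A ℤ) (r : X.carrier → ℝ) : Prop :=
  ∀ ε : ℝ, 0 < ε → ∃ k : ℕ, ∀ (n : ℕ) (x y : X.carrier),
    (∀ i : ℤ, -(k : ℤ) ≤ i → i ≤ (n : ℤ) + k → x.1 i = y.1 i) →
    |∑ j ∈ Finset.range n, (r ((leftShift X)^[j] x) - r ((leftShift X)^[j] y))| < ε

theorem leftShift_bijective (X : Subshift A ℤ) : Function.Bijective (leftShift X) := by
  constructor
  · intro x y h
    apply Subtype.ext
    funext n
    have := congrFun (congrArg Subtype.val h) (n - 1)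
    simpa [leftShift] using this
  · intro x
    refine ⟨⟨shift (-1 : ℤ) x.1, X.mapsTo (-1) x.2⟩, ?_⟩
    apply Subtype.ext
    funext n
    simp [leftShift]

theorem WaltersProperty.continuous [DiscreteTopology A] {X : Subshift A ℤ} {r : X.carrier → ℝ}
    (h : WaltersProperty X r) : Continuous r := by
  rw [continuous_iff_continuousAt]
  intro x
  rw [ContinuousAt, Metric.tendsto_nhds]
  intro ε hε
  obtain ⟨k, hk⟩ := h ε hε
  have hopen : IsOpen {y : X.carrier | y.1 ∈ cylinder (Finset.Icc (-(k : ℤ)) (1 + k)) x.1} :=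
    (isOpen_cylinder _ _).preimage continuous_subtype_val
  filter_upwards [hopen.mem_nhds (fun i _ => rfl)] with y hy
  have := hk 1 y x fun i h1 h2 => hy i (Finset.mem_Icc.mpr ⟨h1, by push_cast at h2; exact h2⟩)
  simpa [Real.dist_eq] using this

/-- A positive function with the Walters property on a shift space over a finite alphabet is
bounded below by a positive constant, so its suspension flow is well defined. -/
theorem WaltersProperty.exists_pos_le [Finite A] [DiscreteTopology A] {X : Subshift A ℤ}
    {r : X.carrier → ℝ} (h : WaltersProperty X r) (hr : ∀ x, 0 < r x) :
    ∃ c : ℝ, 0 < c ∧ ∀ x, c ≤ r x := by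
  have : CompactSpace X.carrier := isCompact_iff_compactSpace.mp X.isClosed.isCompact
  rcases isEmpty_or_nonempty X.carrier with hX | hX
  · exact ⟨1, one_pos, fun x => (hX.false x).elim⟩
  · obtain ⟨x, -, hx⟩ := isCompact_univ.exists_isMinOn Set.univ_nonempty h.continuous.continuousOn
    exact ⟨r x, hr x, fun y => hx (Set.mem_univ y)⟩

end Shift

end SuspensionMixing

/-! The group generated by the Birkhoff sums of `r` over periodic orbits is dense or cyclic. By
finite type and the Walters property, orbit segments can be concatenated
(`eventually_transitTimes_add`) and closed up (`eventually_exists_orbitPeriods`) with an arbitrarily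
small error in their Birkhoff sums.

If the group is dense, inserting periodic loops between two cylinders gives transit times near `C +
N * a + M * b` with `a - b` small and positive. These are eventually dense at any given scale, so
the flow mixes (`isTopologicallyMixing_of_dense`).

Otherwise all periods lie in `δℤ`, where `δ` may be taken below `min r`. Closing up shows that the
transit time from `x₀` to `x` is determined modulo `δ` in the limit of small cylinders. This limit
is a continuous `g : X → ℝ/δℤ` with `g ∘ σ = g + r` (`exists_continuous_circle_transfer`). As `X` is
totally disconnected, `g` lifts to a real function `G`, and `r - (G ∘ σ - G) = δ m` with `m` integer
valued and continuous. Since `δ < min r`, the sums of `m` outgrow `n`, and a further integer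
coboundary makes `m` positive (`exists_int_transfer_pos`). -/

namespace SuspensionMixing

open SymbolicDynamics.FullShift

/-! ### Gluing and closing in shifts of finite type -/

section Symbolic

variable {A : Type*} [TopologicalSpace A]

/-- The translate of a point of a shift space by an integer, `(σ^m x)_i = x_{i+m}`. -/
def translate (X : Subshift A ℤ) (m : ℤ) (x : X.carrier) : X.carrier :=
  ⟨fun i => x.1 (i + m), by
    have h := X.mapsTo m x.2
    have e : shift m x.1 = fun i => x.1 (i + m) := by
      funext n
      simp [add_comm]
    rwa [e] at h⟩

theorem translate_apply (X : Subshift A ℤ) (m : ℤ) (x : X.carrier) (i : ℤ) :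
    (translate X m x).1 i = x.1 (i + m) := rfl

theorem leftShift_iterate (X : Subshift A ℤ) (n : ℕ) (x : X.carrier) :
    (leftShift X)^[n] x = translate X n x := by
  induction n generalizing x with
  | zero => exact Subtype.ext (funext fun i => by simp [translate_apply])
  | succ n ih =>
    rw [Function.iterate_succ_apply, ih]
    refine Subtype.ext (funext fun i => ?_)
    rw [translate_apply, translate_apply, leftShift]
    push_cast
    rw [add_assoc]

theorem translate_translate (X : Subshift A ℤ) (m n : ℤ) (x : X.carrier) :
    translate X m (translate X n x) = translate X (m + n) x :=
  Subtype.ext (funext fun i => by simp only [translate_apply, add_assoc])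

/-- `x` and `y` have the same central block `x_{[-k, k]}`. -/
def CentralAgree {X : Subshift A ℤ} (k : ℕ) (x y : X.carrier) : Prop :=
  ∀ i : ℤ, -(k : ℤ) ≤ i → i ≤ k → x.1 i = y.1 i

theorem CentralAgree.refl {X : Subshift A ℤ} (k : ℕ) (x : X.carrier) : CentralAgree k x x :=
  fun _ _ _ => rfl

theorem CentralAgree.symm {X : Subshift A ℤ} {k : ℕ} {x y : X.carrier}
    (h : CentralAgree k x y) : CentralAgree k y x :=
  fun i h1 h2 => (h i h1 h2).symm

theorem CentralAgree.trans {X : Subshift A ℤ} {k : ℕ} {x y z : X.carrier}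
    (h : CentralAgree k x y) (h' : CentralAgree k y z) : CentralAgree k x z :=
  fun i h1 h2 => (h i h1 h2).trans (h' i h1 h2)

theorem CentralAgree.mono {X : Subshift A ℤ} {k l : ℕ} (hkl : k ≤ l) {x y : X.carrier}
    (h : CentralAgree l x y) : CentralAgree k x y :=
  fun i h1 h2 => h i (by omega) (by omega)

/-- `K` is a memory of `X`: a sequence all of whose blocks of radius `K` appear in points of `X`
belongs to `X`. -/
def HasMemory (X : Subshift A ℤ) (K : ℕ) : Prop :=
  ∀ x : ℤ → A, (∀ i : ℤ, ∃ y : X.carrier, ∀ j : ℤ, i - K ≤ j → j ≤ i + K → x j = y.1 j) →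
    x ∈ X.carrier

/-- With `K` the maximal length of a forbidden word, a forbidden word at `i` lies inside the block
of radius `K` about `i`, so it would appear in a point of `X`. -/
theorem IsOfFiniteType.exists_hasMemory {X : Subshift A ℤ} (h : IsOfFiniteType X) :
    ∃ K, HasMemory X K := by
  obtain ⟨F, hF⟩ := h
  refine ⟨F.sup List.length, fun x hx => (hF x).2 fun w hw i happ => ?_⟩
  obtain ⟨y, hy⟩ := hx i
  refine (hF y.1).1 y.2 w hw i fun j hj => ?_
  have hlen : w.length ≤ F.sup List.length := Finset.le_sup (f := List.length) hw
  rw [← hy (i + j) (by omega) (by omega)]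
  exact happ j hj

/-- Switch from `x` to `y` at the origin. As `K ≤ k`, every block of radius `K` lies in one of the
two half-lines, on which the new sequence equals `x` or `y`. -/
theorem HasMemory.exists_glue {X : Subshift A ℤ} {K : ℕ} (hK : HasMemory X K)
    {k : ℕ} (hk : K ≤ k) {x y : X.carrier} (h : CentralAgree k x y) :
    ∃ z : X.carrier, (∀ i : ℤ, i ≤ k → z.1 i = x.1 i) ∧ ∀ i : ℤ, -(k : ℤ) ≤ i → z.1 i = y.1 i := by
  have h1 : ∀ i : ℤ, i ≤ k → (if i ≤ 0 then x.1 i else y.1 i) = x.1 i := by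
    intro i hi
    split_ifs with h0
    · rfl
    · exact (h i (by omega) hi).symm
  have h2 : ∀ i : ℤ, -(k : ℤ) ≤ i → (if i ≤ 0 then x.1 i else y.1 i) = y.1 i := by
    intro i hi
    split_ifs with h0
    · exact h i hi (by omega)
    · rfl
  refine ⟨⟨fun i => if i ≤ 0 then x.1 i else y.1 i, hK _ fun i => ?_⟩, h1, h2⟩
  rcases le_or_gt i 0 with hi | hi
  · exact ⟨x, fun j _ hj => h1 j (by omega)⟩
  · exact ⟨y, fun j hj _ => h2 j (by omega)⟩

/-- A closing lemma: repeat the block `z_{[0, n)}` periodically. The hypothesis makes `z` itself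
`n`-periodic along `[-k, n + k]`. -/
theorem HasMemory.exists_periodic {X : Subshift A ℤ} {K : ℕ} (hK : HasMemory X K)
    {k : ℕ} (hk : K ≤ k) {n : ℕ} (hn : 0 < n) {z : X.carrier}
    (h : CentralAgree k (translate X n z) z) :
    ∃ p : X.carrier, translate X n p = p ∧
      ∀ i : ℤ, -(k : ℤ) ≤ i → i ≤ n + k → p.1 i = z.1 i := by
  have hn' : (0 : ℤ) < n := by exact_mod_cast hn
  -- Several steps of length `n` are needed because `n` may be smaller than `k`.
  have up : ∀ m : ℕ, ∀ i : ℤ, -(k : ℤ) ≤ i → i + m * n ≤ n + k → z.1 (i + m * n) = z.1 i := by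
    intro m
    induction m with
    | zero => intro i _ _; simp
    | succ m ih =>
      intro i h1 h2
      push_cast at h2 ⊢
      have hmn : (0 : ℤ) ≤ m * n := by positivity
      have e : i + (m + 1) * n = i + m * n + n := by ring
      rw [e] at h2 ⊢
      have := h (i + m * n) (by omega) (by omega)
      rw [translate_apply] at this
      rw [this, ih i h1 (by omega)]
  have shadow : ∀ i : ℤ, -(k : ℤ) ≤ i → i ≤ n + k → z.1 (i % n) = z.1 i := by
    intro i h1 h2
    have hd := Int.emod_add_mul_ediv i n
    have hm0 := Int.emod_nonneg i hn'.ne'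
    have hm1 := Int.emod_lt_of_pos i hn'
    rcases le_or_gt 0 (i / n) with hq | hq
    · obtain ⟨m, hm⟩ := Int.eq_ofNat_of_zero_le hq
      rw [hm, mul_comm] at hd
      have := up m (i % n) (by omega) (by omega)
      rw [hd] at this
      exact this.symm
    · obtain ⟨m, hm⟩ := Int.eq_ofNat_of_zero_le (a := -(i / n)) (by omega)
      have e : i + m * n = i % n := by
        rw [← hm]; linarith
      have := up m i h1 (by omega)
      rwa [e] at this
  -- Translating by a multiple of `n` puts the centre of the block into `[0, n)`, and then the block
  -- lies in `[-k, n + k]`.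
  refine ⟨⟨fun i => z.1 (i % n), hK _ fun i => ⟨translate X (-(i / n * n)) z, fun j h1 h2 => ?_⟩⟩,
    ?_, shadow⟩
  · have hd := Int.emod_add_mul_ediv i n
    rw [mul_comm] at hd
    have hm0 := Int.emod_nonneg i hn'.ne'
    have hm1 := Int.emod_lt_of_pos i hn'
    rw [translate_apply, ← shadow (j + -(i / n * n)) (by omega) (by omega)]
    rw [← neg_mul, Int.add_mul_emod_self_right]
  · refine Subtype.ext (funext fun i => ?_)
    simp [translate_apply]

theorem IsTransitive.exists_transit {X : Subshift A ℤ} (h : IsTransitive X) (k : ℕ)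
    (x y : X.carrier) :
    ∃ (z : X.carrier) (n : ℕ), CentralAgree k z x ∧ CentralAgree k (translate X n z) y := by
  set u : X.carrier → List A := fun x =>
    List.ofFn fun j : Fin (2 * k + 1) => x.1 (-(k : ℤ) + (j : ℕ)) with hu
  have hlen : ∀ x, (u x).length = 2 * k + 1 := fun x => by simp [hu]
  have hget : ∀ x (j : ℕ) (hj : j < (u x).length), (u x)[j] = x.1 (-(k : ℤ) + j) :=
    fun x j hj => by simp only [hu, List.getElem_ofFn]
  have hlang : ∀ x, u x ∈ language X :=
    fun x => ⟨x.1, x.2, -(k : ℤ), fun j hj => (hget x j hj).symm⟩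
  obtain ⟨w, -, z, hz, i, happ⟩ := h _ (hlang x) _ (hlang y)
  -- The origin moves to the centre of the first block; the centres of the two blocks are `2 * k + 1
  -- + w.length` apart.
  refine ⟨translate X (i + k) ⟨z, hz⟩, 2 * k + 1 + w.length, fun j h1 h2 => ?_, fun j h1 h2 => ?_⟩
  · obtain ⟨m, hm⟩ := Int.eq_ofNat_of_zero_le (a := j + k) (by omega)
    have hm' : m < (u x).length := by rw [hlen]; omega
    have := happ m (by simp only [List.length_append]; omega)
    rw [List.getElem_append_left (by simp only [List.length_append]; omega),
      List.getElem_append_left hm', hget x m hm'] at this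
    rw [translate_apply]
    convert this using 2 <;> omega
  · obtain ⟨m, hm⟩ := Int.eq_ofNat_of_zero_le (a := j + k) (by omega)
    have hm' : m < (u y).length := by rw [hlen]; omega
    have := happ ((u x ++ w).length + m) (by simp only [List.length_append] at hm' ⊢; omega)
    rw [List.getElem_append_right (by omega)] at this
    simp only [Nat.add_sub_cancel_left] at this
    rw [hget y m hm', List.length_append, hlen] at this
    rw [translate_translate, translate_apply]
    convert this using 2 <;> push_cast <;> omega

/-! ### Transit times between cylinders -/

/-- The Birkhoff sums of `r` along orbit segments that begin in the cylinder
`{z | z_{[-k, k]} = x_{[-k, k]}}` and end in the cylinder `{z | z_{[-k, k]} = y_{[-k, k]}}`. -/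
def transitTimes (X : Subshift A ℤ) (r : X.carrier → ℝ) (k : ℕ) (x y : X.carrier) : Set ℝ :=
  {t | ∃ (z : X.carrier) (n : ℕ), CentralAgree k z x ∧ CentralAgree k (translate X n z) y ∧
    t = birkhoffSum (leftShift X) r n z}

variable {X : Subshift A ℤ} {r : X.carrier → ℝ}

theorem transitTimes_nonempty (h : IsTransitive X) (k : ℕ) (x y : X.carrier) :
    (transitTimes X r k x y).Nonempty := by
  obtain ⟨z, n, h1, h2⟩ := h.exists_transit k x y
  exact ⟨_, z, n, h1, h2, rfl⟩

theorem transitTimes_anti {k l : ℕ} (hkl : k ≤ l) (x y : X.carrier) :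
    transitTimes X r l x y ⊆ transitTimes X r k x y := by
  rintro t ⟨z, n, h1, h2, rfl⟩
  exact ⟨z, n, h1.mono hkl, h2.mono hkl, rfl⟩

theorem transitTimes_congr_right {k : ℕ} (x : X.carrier) {y y' : X.carrier}
    (h : CentralAgree k y y') : transitTimes X r k x y = transitTimes X r k x y' := by
  ext t
  constructor
  · rintro ⟨z, n, h1, h2, rfl⟩
    exact ⟨z, n, h1, h2.trans h, rfl⟩
  · rintro ⟨z, n, h1, h2, rfl⟩
    exact ⟨z, n, h1, h2.trans h.symm, rfl⟩

theorem WaltersProperty.eventually_birkhoffSum (h : WaltersProperty X r) {ε : ℝ} (hε : 0 < ε) :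
    ∀ᶠ k : ℕ in Filter.atTop, ∀ (n : ℕ) (x y : X.carrier),
      (∀ i : ℤ, -(k : ℤ) ≤ i → i ≤ (n : ℤ) + k → x.1 i = y.1 i) →
      |birkhoffSum (leftShift X) r n x - birkhoffSum (leftShift X) r n y| < ε := by
  obtain ⟨k₀, hk₀⟩ := h ε hε
  filter_upwards [Filter.eventually_ge_atTop k₀] with k hk n x y hxy
  rw [birkhoffSum, birkhoffSum, ← Finset.sum_sub_distrib]
  exact hk₀ n x y fun i h1 h2 => hxy i (by omega) (by omega)

/-- Glue the end of the first segment to the start of the second, both being in the cylinder of `y`.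
Each half then costs at most `ε / 2` by the Walters property. -/
theorem eventually_transitTimes_add (hfin : IsOfFiniteType X) (h : WaltersProperty X r)
    {ε : ℝ} (hε : 0 < ε) :
    ∀ᶠ k : ℕ in Filter.atTop, ∀ (x y w : X.carrier), ∀ t ∈ transitTimes X r k x y,
      ∀ t' ∈ transitTimes X r k y w, ∃ t'' ∈ transitTimes X r k x w, |t'' - (t + t')| < ε := by
  obtain ⟨K, hK⟩ := hfin.exists_hasMemory
  filter_upwards [Filter.eventually_ge_atTop K, h.eventually_birkhoffSum (half_pos hε)]
    with k hk hw x y w t ht t' ht'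
  obtain ⟨z, n, h1, h2, rfl⟩ := ht
  obtain ⟨z', n', h1', h2', rfl⟩ := ht'
  -- The origin of `v` is the junction, so the orbit segment starts at `translate X (-n) v`.
  obtain ⟨v, hv1, hv2⟩ := hK.exists_glue hk (h2.trans h1'.symm)
  have e1 : translate X n (translate X (-n) v) = v := by
    rw [translate_translate, add_neg_cancel]
    exact Subtype.ext (funext fun i => by simp [translate_apply])
  have a1 : ∀ i : ℤ, i ≤ n + k → (translate X (-n) v).1 i = z.1 i := by
    intro i hi
    rw [translate_apply, hv1 _ (by omega), translate_apply, neg_add_cancel_right]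
  refine ⟨_, ⟨translate X (-n) v, n + n', fun i hi1 hi2 => ?_, fun i hi1 hi2 => ?_, rfl⟩, ?_⟩
  · rw [a1 i (by omega), h1 i hi1 hi2]
  · rw [← h2' i hi1 hi2, Nat.cast_add, add_comm, ← translate_translate, e1]
    exact hv2 _ (by omega)
  · rw [birkhoffSum_add, leftShift_iterate, e1]
    have b1 := hw n (translate X (-n) v) z fun i _ hi => a1 i hi
    have b2 := hw n' v z' fun i hi _ => hv2 i hi
    rw [abs_lt] at b1 b2 ⊢
    constructor <;> linarith

/-- The Birkhoff sums of `r` over periodic orbits. -/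
def orbitPeriods (X : Subshift A ℤ) (r : X.carrier → ℝ) : Set ℝ :=
  {t | ∃ (p : X.carrier) (n : ℕ), translate X n p = p ∧ t = birkhoffSum (leftShift X) r n p}

theorem eventually_exists_orbitPeriods (hfin : IsOfFiniteType X) (h : WaltersProperty X r)
    {ε : ℝ} (hε : 0 < ε) :
    ∀ᶠ k : ℕ in Filter.atTop, ∀ x : X.carrier, ∀ t ∈ transitTimes X r k x x,
      ∃ τ ∈ orbitPeriods X r, |t - τ| < ε := by
  obtain ⟨K, hK⟩ := hfin.exists_hasMemory
  filter_upwards [Filter.eventually_ge_atTop K, h.eventually_birkhoffSum hε]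
    with k hk hw x t ht
  obtain ⟨z, n, h1, h2, rfl⟩ := ht
  rcases Nat.eq_zero_or_pos n with rfl | hn
  -- A segment of length zero has sum zero, which counts as an orbit period.
  · exact ⟨_, ⟨z, 0, Subtype.ext (funext fun i => by simp [translate_apply]), rfl⟩, by simpa⟩
  · obtain ⟨p, hp1, hp2⟩ := hK.exists_periodic hk hn (h2.trans h1.symm)
    exact ⟨_, ⟨p, n, hp1, rfl⟩, hw n z p fun i hi1 hi2 => (hp2 i hi1 hi2).symm⟩

/-- `a` can be inserted arbitrarily often in itineraries between any two cylinders. -/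
def IsInsertable (X : Subshift A ℤ) (r : X.carrier → ℝ) (a : ℝ) : Prop :=
  ∀ ε : ℝ, 0 < ε → ∀ᶠ k : ℕ in Filter.atTop, ∀ x y : X.carrier, ∃ C : ℝ, ∀ N : ℕ,
    ∃ t ∈ transitTimes X r k x y, |t - (C + N * a)| < ε

/-- Go from `x` to the periodic point, run around it `N` times, then go to `y`. The loop time is
exactly `N * a`, so only two concatenations cause errors, whatever `N` is. -/
theorem isInsertable_of_mem_orbitPeriods (hfin : IsOfFiniteType X) (htrans : IsTransitive X)
    (h : WaltersProperty X r) {a : ℝ} (ha : a ∈ orbitPeriods X r) : IsInsertable X r a := by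
  intro ε hε
  obtain ⟨p, n, hp, rfl⟩ := ha
  filter_upwards [eventually_transitTimes_add hfin h (half_pos hε)] with k hk x y
  obtain ⟨t₁, ht₁⟩ := transitTimes_nonempty (r := r) htrans k x p
  obtain ⟨t₂, ht₂⟩ := transitTimes_nonempty (r := r) htrans k p y
  refine ⟨t₁ + t₂, fun N => ?_⟩
  have hiter : ∀ N : ℕ, translate X (N * n : ℕ) p = p ∧
      birkhoffSum (leftShift X) r (N * n) p = N * birkhoffSum (leftShift X) r n p := by
    intro N
    induction N with
    | zero => exact ⟨Subtype.ext (funext fun i => by simp [translate_apply]), by simp⟩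
    | succ N ih =>
      constructor
      · rw [Nat.succ_mul, Nat.cast_add, ← translate_translate, hp, ih.1]
      · rw [Nat.succ_mul, birkhoffSum_add, leftShift_iterate, ih.1, ih.2]
        push_cast
        ring
  have hloop : N * birkhoffSum (leftShift X) r n p ∈ transitTimes X r k p p :=
    ⟨p, N * n, .refl _ _, by rw [(hiter N).1]; exact .refl _ _, (hiter N).2.symm⟩
  obtain ⟨t₃, ht₃, h₃⟩ := hk x p p t₁ ht₁ _ hloop
  obtain ⟨t₄, ht₄, h₄⟩ := hk x p y t₃ ht₃ t₂ ht₂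
  refine ⟨t₄, ht₄, ?_⟩
  rw [abs_lt] at *
  constructor <;> linarith

theorem IsInsertable.two (hfin : IsOfFiniteType X) (h : WaltersProperty X r) {a b : ℝ}
    (ha : IsInsertable X r a) (hb : IsInsertable X r b) {ε : ℝ} (hε : 0 < ε) :
    ∀ᶠ k : ℕ in Filter.atTop, ∀ x y : X.carrier, ∃ C : ℝ, ∀ N M : ℕ,
      ∃ t ∈ transitTimes X r k x y, |t - (C + N * a + M * b)| < ε := by
  have hε' : 0 < ε / 3 := by positivity
  filter_upwards [ha _ hε', hb _ hε', eventually_transitTimes_add hfin h hε'] with k ha hb hk x y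
  obtain ⟨C, hC⟩ := ha x x
  obtain ⟨D, hD⟩ := hb x y
  refine ⟨C + D, fun N M => ?_⟩
  obtain ⟨t, ht, h1⟩ := hC N
  obtain ⟨t', ht', h2⟩ := hD M
  obtain ⟨t'', ht'', h3⟩ := hk x x y t ht t' ht'
  refine ⟨t'', ht'', ?_⟩
  rw [abs_lt] at *
  constructor <;> linarith

theorem isInsertable_of_mem_closure (hfin : IsOfFiniteType X) (htrans : IsTransitive X)
    (h : WaltersProperty X r) {a : ℝ} (ha : a ∈ AddSubmonoid.closure (orbitPeriods X r)) :
    IsInsertable X r a := by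
  induction ha using AddSubmonoid.closure_induction with
  | mem a ha => exact isInsertable_of_mem_orbitPeriods hfin htrans h ha
  | zero =>
    refine fun ε hε => .of_forall fun k x y => ?_
    obtain ⟨t, ht⟩ := transitTimes_nonempty (r := r) htrans k x y
    exact ⟨t, fun N => ⟨t, ht, by simpa⟩⟩
  | add a b _ _ iha ihb =>
    intro ε hε
    filter_upwards [iha.two hfin h ihb hε] with k hk x y
    obtain ⟨C, hC⟩ := hk x y
    refine ⟨C, fun N => ?_⟩
    obtain ⟨t, ht, h1⟩ := hC N N
    exact ⟨t, ht, by rwa [mul_add, ← add_assoc]⟩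

/-! ### Dense period groups -/

/-- Only nonnegative combinations of periods can be inserted in itineraries, so a small positive
group element is split as a difference of two of them. -/
theorem exists_mem_closure_sub_mem_Ioo {P : Set ℝ}
    (hd : Dense (AddSubgroup.closure P : Set ℝ)) {ε : ℝ} (hε : 0 < ε) :
    ∃ a ∈ AddSubmonoid.closure P, ∃ b ∈ AddSubmonoid.closure P, 0 < a - b ∧ a - b < ε := by
  have hsub : ∀ g ∈ AddSubgroup.closure P,
      ∃ a ∈ AddSubmonoid.closure P, ∃ b ∈ AddSubmonoid.closure P, g = a - b := by
    intro g hg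
    induction hg using AddSubgroup.closure_induction with
    | mem g hg => exact ⟨g, AddSubmonoid.subset_closure hg, 0, zero_mem _, by simp⟩
    | zero => exact ⟨0, zero_mem _, 0, zero_mem _, by simp⟩
    | add g g' _ _ ih ih' =>
      obtain ⟨a, ha, b, hb, rfl⟩ := ih
      obtain ⟨a', ha', b', hb', rfl⟩ := ih'
      exact ⟨a + a', add_mem ha ha', b + b', add_mem hb hb', by ring⟩
    | neg g _ ih =>
      obtain ⟨a, ha, b, hb, rfl⟩ := ih
      exact ⟨b, hb, a, ha, by ring⟩
  obtain ⟨g, hg, h1, h2⟩ := hd.exists_between hε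
  obtain ⟨a, ha, b, hb, rfl⟩ := hsub g hg
  exact ⟨a, ha, b, hb, h1, h2⟩

/-- Fill `t` with copies of `b`, then exchange some of them for `a`; each exchange gains `a - b <
ε`. -/
theorem exists_nat_combination_near {a b ε : ℝ} (hb : 0 ≤ b) (hab : 0 < a - b)
    (hε : a - b < ε) :
    ∃ T : ℝ, ∀ t : ℝ, T ≤ t → ∃ N M : ℕ, |t - (N * a + M * b)| < ε := by
  rcases hb.eq_or_lt with rfl | hb
  · rw [sub_zero] at hab hε
    refine ⟨0, fun t ht => ⟨⌊t / a⌋₊, 0, ?_⟩⟩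
    have h1 := Nat.floor_le (div_nonneg ht hab.le)
    have h2 := Nat.lt_floor_add_one (t / a)
    rw [le_div_iff₀ hab] at h1
    rw [div_lt_iff₀ hab] at h2
    rw [abs_lt]
    constructor <;> linarith
  · obtain ⟨J, hJ⟩ := exists_nat_gt (b / (a - b))
    -- The remainder below `b` takes at most `J` exchanges, and beyond `J * b` at least `J` copies
    -- are available.
    refine ⟨J * b, fun t ht => ?_⟩
    have ht0 : 0 ≤ t := le_trans (by positivity) ht
    have h1 := Nat.floor_le (div_nonneg ht0 hb.le)
    have h2 := Nat.lt_floor_add_one (t / b)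
    have hq : J ≤ ⌊t / b⌋₊ := Nat.le_floor ((le_div_iff₀ hb).2 ht)
    rw [le_div_iff₀ hb] at h1
    rw [div_lt_iff₀ hb] at h2
    generalize ⌊t / b⌋₊ = q at *
    have hrem : 0 ≤ t - q * b := by linarith
    have h3 := Nat.floor_le (div_nonneg hrem hab.le)
    have h4 := Nat.lt_floor_add_one ((t - q * b) / (a - b))
    have hj : ⌊(t - q * b) / (a - b)⌋₊ ≤ J := by
      have : (⌊(t - q * b) / (a - b)⌋₊ : ℝ) ≤ J := by
        refine h3.trans (le_trans ?_ hJ.le)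
        gcongr
        linarith
      exact_mod_cast this
    rw [le_div_iff₀ hab] at h3
    rw [div_lt_iff₀ hab] at h4
    generalize ⌊(t - q * b) / (a - b)⌋₊ = j at *
    obtain ⟨m, rfl⟩ := Nat.exists_eq_add_of_le (hj.trans hq)
    refine ⟨j, m, ?_⟩
    push_cast at *
    rw [abs_lt]
    constructor <;> linarith

theorem eventually_transitTimes_dense (hfin : IsOfFiniteType X) (htrans : IsTransitive X)
    (hpos : ∀ x, 0 < r x) (h : WaltersProperty X r)
    (hd : Dense (AddSubgroup.closure (orbitPeriods X r) : Set ℝ)) {ε : ℝ} (hε : 0 < ε) :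
    ∀ᶠ k : ℕ in Filter.atTop, ∀ x y : X.carrier, ∃ T : ℝ, ∀ t : ℝ, T ≤ t →
      ∃ τ ∈ transitTimes X r k x y, |τ - t| < ε := by
  obtain ⟨a, ha, b, hb, hab, hab'⟩ := exists_mem_closure_sub_mem_Ioo hd (half_pos hε)
  have hnonneg : ∀ b ∈ AddSubmonoid.closure (orbitPeriods X r), 0 ≤ b := by
    intro b hb
    induction hb using AddSubmonoid.closure_induction with
    | mem b hb =>
      obtain ⟨p, n, -, rfl⟩ := hb
      exact Finset.sum_nonneg fun i _ => (hpos _).le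
    | zero => exact le_rfl
    | add a b _ _ iha ihb => exact add_nonneg iha ihb
  obtain ⟨T, hT⟩ := exists_nat_combination_near (hnonneg b hb) hab hab'
  filter_upwards [(isInsertable_of_mem_closure hfin htrans h ha).two hfin h
    (isInsertable_of_mem_closure hfin htrans h hb) (half_pos hε)] with k hk x y
  obtain ⟨C, hC⟩ := hk x y
  refine ⟨C + T, fun t ht => ?_⟩
  obtain ⟨N, M, hNM⟩ := hT (t - C) (by linarith)
  obtain ⟨τ, hτ, h1⟩ := hC N M
  refine ⟨τ, hτ, ?_⟩
  rw [abs_lt] at *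
  constructor <;> linarith

end Symbolic

/-! ### Topological mixing of the suspension flow -/

section Mixing

variable {A : Type*} [TopologicalSpace A] {X : Subshift A ℤ} {r : X.carrier → ℝ}

theorem eventually_centralAgree_imp {p : X.carrier → Prop} {x : X.carrier}
    (h : ∀ᶠ y in 𝓝 x, p y) : ∀ᶠ k : ℕ in Filter.atTop, ∀ y, CentralAgree k y x → p y := by
  obtain ⟨V, hV, hVp⟩ := mem_nhds_induced _ _ _ |>.1 h
  rw [nhds_pi, Filter.mem_pi] at hV
  obtain ⟨I, hI, t, ht, hIt⟩ := hV
  have hb : ∀ᶠ k : ℕ in Filter.atTop, ∀ i ∈ I, i.natAbs ≤ k :=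
    hI.eventually_all.2 fun i _ => Filter.eventually_ge_atTop _
  filter_upwards [hb] with k hk y hy
  refine hVp (hIt fun i hi => ?_)
  have := hk i hi
  rw [hy i (by omega) (by omega)]
  exact mem_of_mem_nhds (ht i)

theorem exists_box_subset (hr : Continuous r) (hpos : ∀ x, 0 < r x)
    {U : Set (SuspensionSpace (leftShift X) r)} (hU : IsOpen U) (hne : U.Nonempty) :
    ∃ (x : X.carrier) (s η : ℝ), 0 < η ∧ ∀ᶠ k : ℕ in Filter.atTop, ∀ x', CentralAgree k x' x →
      ∀ s' : ℝ, |s' - s| < η → ∃ h : 0 ≤ s' ∧ s' ≤ r x',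
        SuspensionSpace.mk (leftShift X) r ⟨(x', s'), h⟩ ∈ U := by
  obtain ⟨p, hp⟩ := hne
  obtain ⟨⟨⟨x, s₀⟩, hs0, hs1⟩, rfl⟩ : ∃ a, SuspensionSpace.mk (leftShift X) r a = p :=
    Quot.exists_rep p
  have hpre : IsOpen (SuspensionSpace.mk (leftShift X) r ⁻¹' U) := hU.preimage continuous_quot_mk
  obtain ⟨W, hW, hWU⟩ := isOpen_induced_iff.1 hpre
  have hmem : ∀ a : RoofRegion r, a.1 ∈ W → SuspensionSpace.mk (leftShift X) r a ∈ U := by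
    intro a ha
    have : a ∈ Subtype.val ⁻¹' W := ha
    rwa [hWU] at this
  have hx : (x, s₀) ∈ W := by
    have : (⟨(x, s₀), hs0, hs1⟩ : RoofRegion r) ∈ Subtype.val ⁻¹' W := by rw [hWU]; exact hp
    exact this
  -- The given height may be `0` or `r x`; it is moved strictly inside, so that a full box fits into
  -- the roof region.
  have hcl : s₀ ∈ closure (Set.Ioo 0 (r x)) := by
    rw [closure_Ioo (hpos x).ne]
    exact ⟨hs0, hs1⟩
  obtain ⟨s, hsW, hs⟩ := mem_closure_iff.1 hcl {s | (x, s) ∈ W}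
    (hW.preimage (by fun_prop)) hx
  have hopen : IsOpen (W ∩ {q : X.carrier × ℝ | 0 < q.2 ∧ q.2 < r q.1}) :=
    hW.inter ((isOpen_lt continuous_const continuous_snd).inter
      (isOpen_lt continuous_snd (hr.comp continuous_fst)))
  have hnhds := hopen.mem_nhds (x := (x, s)) ⟨hsW, hs⟩
  rw [nhds_prod_eq, Filter.mem_prod_iff] at hnhds
  obtain ⟨N, hN, J, hJ, hNJ⟩ := hnhds
  obtain ⟨η, hη, hηJ⟩ := Metric.mem_nhds_iff.1 hJ
  refine ⟨x, s, η, hη, ?_⟩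
  filter_upwards [eventually_centralAgree_imp hN] with k hk x' hx' s' hs'
  have hq := hNJ (Set.mk_mem_prod (hk x' hx') (hηJ (Metric.mem_ball.2 hs')))
  exact ⟨⟨hq.2.1.le, hq.2.2.le⟩, hmem _ hq.1⟩

variable [DiscreteTopology A]

theorem eventually_nhds_centralAgree (k : ℕ) (x : X.carrier) :
    ∀ᶠ y in 𝓝 x, CentralAgree k y x := by
  have hopen : IsOpen {y : X.carrier | y.1 ∈ cylinder (Finset.Icc (-(k : ℤ)) k) x.1} :=
    (isOpen_cylinder _ _).preimage continuous_subtype_val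
  filter_upwards [hopen.mem_nhds (fun i _ => rfl)] with y hy
  exact fun i h1 h2 => hy i (Finset.mem_Icc.2 ⟨h1, h2⟩)

theorem isTopologicallyMixing_of_dense [Finite A] (hfin : IsOfFiniteType X)
    (htrans : IsTransitive X) (hpos : ∀ x, 0 < r x) (h : WaltersProperty X r)
    (hd : Dense (AddSubgroup.closure (orbitPeriods X r) : Set ℝ)) :
    IsTopologicallyMixing (suspensionFlow (leftShift X) r) := by
  intro U V hU hUne hV hVne
  obtain ⟨x, s, η, hη, hxU⟩ := exists_box_subset h.continuous hpos hU hUne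
  obtain ⟨y, u, ξ, hξ, hyV⟩ := exists_box_subset h.continuous hpos hV hVne
  obtain ⟨k, hkU, hkV, hk⟩ := (hxU.and (hyV.and
    (eventually_transitTimes_dense hfin htrans hpos h hd hξ))).exists
  obtain ⟨T, hT⟩ := hk x y
  -- The time is nonnegative, so the flow runs forward, and `t + s - u` is past the threshold `T`.
  refine ⟨max 0 (T - s + u), fun t ht => ?_⟩
  obtain ⟨_, ⟨z, n, hz1, hz2, rfl⟩, hτ⟩ := hT (t + s - u) (by linarith [le_of_max_le_right ht])
  obtain ⟨ha, haU⟩ := hkU z hz1 s (by simpa)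
  -- Starting at height exactly `s`, the error in the transit time only shifts the landing height,
  -- by less than `ξ` from `u`.
  obtain ⟨hb, hbV⟩ := hkV _ hz2 (t + s - birkhoffSum (leftShift X) r n z) (by
    rw [abs_sub_comm]
    convert hτ using 2
    ring)
  obtain ⟨c, hc0, hc⟩ := h.exists_pos_le hpos
  refine ⟨_, ⟨_, haU, ?_⟩, hbV⟩
  rw [suspensionFlow_eq_iff (leftShift_bijective X) hc0 hc]
  exact Or.inl ⟨le_of_max_le_left ht, _, _, n, rfl, rfl, (leftShift_iterate X n z).symm, by
    simp only
    ring⟩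

end Mixing

/-! ### Roof functions with discrete orbit periods -/

section Cohomology

theorem norm_addCircle_coe_le_abs (δ t : ℝ) : ‖(t : AddCircle δ)‖ ≤ |t| :=
  QuotientAddGroup.norm_mk_le_norm

variable {A : Type*} [TopologicalSpace A] {X : Subshift A ℤ} {r : X.carrier → ℝ}

/-- Close both segments with the same return `w` from `y` to `x`. Then `t + w` and `t' + w` are both
near orbit periods, so `t - t'` is near `δℤ`. -/
theorem eventually_dist_transitTimes_lt (hfin : IsOfFiniteType X) (htrans : IsTransitive X)
    (h : WaltersProperty X r) {δ : ℝ}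
    (hP : ∀ τ ∈ orbitPeriods X r, (τ : AddCircle δ) = 0) {ε : ℝ} (hε : 0 < ε) :
    ∀ᶠ k : ℕ in Filter.atTop, ∀ x y : X.carrier, ∀ t ∈ transitTimes X r k x y,
      ∀ t' ∈ transitTimes X r k x y, dist (t : AddCircle δ) t' < ε := by
  have hε' : 0 < ε / 4 := by positivity
  filter_upwards [eventually_transitTimes_add hfin h hε', eventually_exists_orbitPeriods hfin h hε']
    with k hadd hper x y t ht t' ht'
  obtain ⟨w, hw⟩ := transitTimes_nonempty (r := r) htrans k y x
  obtain ⟨v, hv, h1⟩ := hadd x y x t ht w hw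
  obtain ⟨v', hv', h1'⟩ := hadd x y x t' ht' w hw
  obtain ⟨τ, hτ, h2⟩ := hper x v hv
  obtain ⟨τ', hτ', h2'⟩ := hper x v' hv'
  have e : (t : AddCircle δ) - t' = ((t - t' - (τ - τ') : ℝ) : AddCircle δ) := by
    rw [AddCircle.coe_sub, AddCircle.coe_sub, AddCircle.coe_sub, hP τ hτ, hP τ' hτ']
    simp
  rw [dist_eq_norm, e]
  refine (norm_addCircle_coe_le_abs _ _).trans_lt ?_
  rw [abs_lt] at *
  constructor <;> linarith

theorem exists_continuous_circle_transfer [DiscreteTopology A] (hfin : IsOfFiniteType X)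
    (htrans : IsTransitive X) (h : WaltersProperty X r) (x₀ : X.carrier) {δ : ℝ}
    [hδ : Fact (0 < δ)] (hP : ∀ τ ∈ orbitPeriods X r, (τ : AddCircle δ) = 0) :
    ∃ g : X.carrier → AddCircle δ, Continuous g ∧
      ∀ x, g (leftShift X x) = g x + (r x : AddCircle δ) := by
  -- Compactness of the circle provides a limit, modulo `δ`, of transit times into shrinking
  -- cylinders about `x`.
  have hex : ∀ x, (⋂ k : ℕ, closure ((fun t : ℝ => (t : AddCircle δ)) ''
      transitTimes X r k x₀ x)).Nonempty := fun x =>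
    IsCompact.nonempty_iInter_of_sequence_nonempty_isCompact_isClosed _
      (fun k => closure_mono (Set.image_mono (transitTimes_anti k.le_succ x₀ x)))
      (fun k => ((transitTimes_nonempty htrans k x₀ x).image _).closure)
      isClosed_closure.isCompact fun _ => isClosed_closure
  choose g hg using hex
  have near : ∀ (k : ℕ) (x : X.carrier) (ε : ℝ), 0 < ε →
      ∃ t ∈ transitTimes X r k x₀ x, dist (g x) (t : AddCircle δ) < ε := by
    intro k x ε hε
    obtain ⟨_, ⟨t, ht, rfl⟩, h1⟩ := Metric.mem_closure_iff.1 (Set.mem_iInter.1 (hg x) k) ε hε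
    exact ⟨t, ht, h1⟩
  refine ⟨g, ?_, fun x => ?_⟩
  · rw [continuous_iff_continuousAt]
    intro x
    rw [ContinuousAt, Metric.tendsto_nhds]
    intro ε hε
    have hε' : 0 < ε / 3 := by positivity
    obtain ⟨k, hk⟩ := (eventually_dist_transitTimes_lt hfin htrans h hP hε').exists
    filter_upwards [eventually_nhds_centralAgree k x] with y hy
    obtain ⟨t, ht, h1⟩ := near k x _ hε'
    obtain ⟨t', ht', h2⟩ := near k y _ hε'
    rw [transitTimes_congr_right x₀ hy] at ht'
    have h3 := hk x₀ x t ht t' ht'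
    have h4 := dist_triangle4 (g y) (t' : AddCircle δ) t (g x)
    rw [dist_comm (t : AddCircle δ) (g x), dist_comm (t' : AddCircle δ) t] at h4
    linarith
  · refine dist_le_zero.1 (le_of_forall_pos_le_add fun ε hε => ?_)
    have hε' : 0 < ε / 4 := by positivity
    obtain ⟨k, hk, hr⟩ := ((eventually_dist_transitTimes_lt hfin htrans h hP hε').and
      (eventually_centralAgree_imp
        (Metric.continuousAt_iff'.1 h.continuous.continuousAt (ε / 4) hε'))).exists
    -- Extending the segment by one step to reach `σ x` costs one coordinate of the central block,
    -- hence radius `k + 1`.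
    obtain ⟨t, ht, h1⟩ := near (k + 1) x _ hε'
    obtain ⟨t', ht', h2⟩ := near k (leftShift X x) _ hε'
    obtain ⟨z, n, hz1, hz2, rfl⟩ := ht
    have hmem : birkhoffSum (leftShift X) r (n + 1) z ∈ transitTimes X r k x₀ (leftShift X x) := by
      refine ⟨z, n + 1, hz1.mono k.le_succ, fun i h1 h2 => ?_, rfl⟩
      have := hz2 (i + 1) (by push_cast; omega) (by push_cast; omega)
      rw [translate_apply] at this ⊢
      push_cast
      rw [add_comm (n : ℤ), ← add_assoc, this]
      rfl
    have h3 := hk x₀ _ t' ht' _ hmem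
    have h4 := hr _ (hz2.mono k.le_succ)
    rw [birkhoffSum_succ, leftShift_iterate] at h3
    generalize birkhoffSum (leftShift X) r n z = t at *
    have h5 : dist ((t + r (translate X n z) : ℝ) : AddCircle δ) (g x + (r x : AddCircle δ))
        < ε / 4 + ε / 4 := by
      rw [AddCircle.coe_add]
      refine (dist_add_add_le _ _ _ _).trans_lt (add_lt_add ?_ ?_)
      · rwa [dist_comm]
      · rw [dist_eq_norm, ← AddCircle.coe_sub]
        exact (norm_addCircle_coe_le_abs _ _).trans_lt h4
    have h6 := dist_triangle4 (g (leftShift X x)) (t' : AddCircle δ)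
      ((t + r (translate X n z) : ℝ) : AddCircle δ) (g x + (r x : AddCircle δ))
    linarith

/-- Circle-valued continuous functions on a compact totally disconnected space lift to `ℝ`. -/
theorem exists_continuous_lift_addCircle {Y : Type*} [TopologicalSpace Y] [CompactSpace Y]
    [T2Space Y] [TotallyDisconnectedSpace Y] {δ : ℝ} [hδ : Fact (0 < δ)] {g : Y → AddCircle δ}
    (hg : Continuous g) : ∃ G : Y → ℝ, Continuous G ∧ ∀ y, (G y : AddCircle δ) = g y := by
  classical
  have hne : ((δ / 2 : ℝ) : AddCircle δ) ≠ ((0 : ℝ) : AddCircle δ) := by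
    rw [AddCircle.coe_zero, Ne, AddCircle.coe_eq_zero_iff]
    rintro ⟨n, hn⟩
    rw [zsmul_eq_mul] at hn
    have h2 : ((2 * n : ℤ) : ℝ) = (1 : ℤ) := by
      push_cast
      exact mul_right_cancel₀ hδ.out.ne' (by linarith)
    have := Int.cast_injective h2
    omega
  -- A clopen set containing `g = 0` and missing `g = δ / 2`: the branch cut at `δ / 2` is safe on
  -- it, the one at `0` on its complement.
  obtain ⟨C, hC, hZC, hCU⟩ := exists_clopen_of_closed_subset_open
    (Z := g ⁻¹' {((0 : ℝ) : AddCircle δ)}) (U := g ⁻¹' {((δ / 2 : ℝ) : AddCircle δ)}ᶜ)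
    (isClosed_singleton.preimage hg) (isClosed_singleton.isOpen_compl.preimage hg)
    (fun y hy hy' => hne (hy'.symm.trans hy))
  have hlift : ∀ (a : ℝ) (y : Y), g y ≠ a →
      ContinuousAt (fun y => ((AddCircle.equivIco δ a (g y) : Set.Ico a (a + δ)) : ℝ)) y :=
    fun a y hy => continuousAt_subtype_val.comp
      ((AddCircle.continuousAt_equivIco δ a hy).comp hg.continuousAt)
  refine ⟨fun y => if y ∈ C then (AddCircle.equivIco δ (δ / 2) (g y) : ℝ)
    else (AddCircle.equivIco δ 0 (g y) : ℝ), ?_, fun y => ?_⟩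
  · refine continuous_if (p := fun y => y ∈ C) ?_ ?_ ?_
    · intro y hy
      rw [Set.ofPred_mem_eq, hC.frontier_eq] at hy
      exact hy.elim
    · rw [Set.ofPred_mem_eq, hC.isClosed.closure_eq]
      exact fun y hy => (hlift _ y (hCU hy)).continuousWithinAt
    · have e : {y | y ∉ C} = Cᶜ := rfl
      rw [e, hC.compl.isClosed.closure_eq]
      exact fun y hy => (hlift _ y fun h0 => hy (hZC h0)).continuousWithinAt
  · dsimp only
    split_ifs <;> exact AddCircle.coe_equivIco

theorem continuous_leftShift (X : Subshift A ℤ) : Continuous (leftShift X) :=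
  continuous_induced_rng.2 (continuous_pi fun n =>
    (continuous_apply (n + 1)).comp continuous_subtype_val)

end Cohomology

/-! ### Making an integer cocycle positive -/

/-- An integer-valued cocycle whose Birkhoff sums eventually dominate `n` uniformly is cohomologous
to a positive one. -/
theorem exists_int_transfer_pos {Y : Type*} [TopologicalSpace Y] {f : Y → Y} (hf : Continuous f)
    {m : Y → ℤ} (hm : Continuous m) {N : ℕ}
    (hN : ∀ y, 0 ≤ birkhoffSum f m (N + 1) y - (N + 1)) :
    ∃ u : Y → ℤ, Continuous u ∧ ∀ y, 0 < m y + u (f y) - u y := by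
  have hcont : ∀ n, Continuous fun y => birkhoffSum f m n y - n := fun n =>
    (continuous_finsetSum _ fun i _ => hm.comp (hf.iterate i)).sub continuous_const
  have hne : (Finset.range (N + 1)).Nonempty := ⟨0, by simp⟩
  -- For `u = min_{n ≤ N} (S_n m - n)`, passing from `f y` to `y` lengthens each sum by one term, so
  -- `u y ≤ m y + u (f y) - 1`.
  refine ⟨fun y => (Finset.range (N + 1)).inf' hne fun n => birkhoffSum f m n y - n,
    Continuous.finset_inf'_apply hne fun n _ => hcont n, fun y => ?_⟩
  obtain ⟨n, hn, he⟩ := Finset.exists_mem_eq_inf' hne fun n : ℕ => birkhoffSum f m n (f y) - (n : ℤ)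
  beta_reduce
  rw [he]
  have hs := birkhoffSum_succ' f m n y
  have key : (Finset.range (N + 1)).inf' hne (fun n => birkhoffSum f m n y - (n : ℤ)) ≤
      birkhoffSum f m (n + 1) y - (n + 1 : ℕ) := by
    rcases (Nat.lt_succ_iff.1 (Finset.mem_range.1 hn)).lt_or_eq with hlt | rfl
    · exact Finset.inf'_le (fun n => birkhoffSum f m n y - (n : ℤ))
        (Finset.mem_range.2 (Nat.succ_lt_succ hlt))
    -- For `n = N` the lengthened sum leaves the range, but `hN` bounds it below by `0`, the term of
    -- index `0`.
    · refine (Finset.inf'_le _ (Finset.mem_range.2 n.succ_pos)).trans ?_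
      have := hN y
      simpa using this
  push_cast at key
  omega

end SuspensionMixing

/-! ### The main theorem -/

theorem theorem3p4 {A : Type*} [Finite A] [TopologicalSpace A] [DiscreteTopology A]
    (X : SymbolicDynamics.FullShift.Subshift A ℤ)
    (hfin : SuspensionMixing.IsOfFiniteType X) (htrans : SuspensionMixing.IsTransitive X)
    (r : X.carrier → ℝ) (hpos : ∀ x, 0 < r x) (hW : SuspensionMixing.WaltersProperty X r)
    (hmix : ¬ SuspensionMixing.IsTopologicallyMixing
      (SuspensionMixing.suspensionFlow (SuspensionMixing.leftShift X) r)) :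
    ∃ δ : ℝ, 0 < δ ∧ ∃ s : X.carrier → ℝ,
      IsLocallyConstant s ∧ (∀ x, 0 < s x) ∧ (∀ x, ∃ n : ℕ, s x = δ * n) ∧
      SuspensionMixing.Cohomologous (SuspensionMixing.leftShift X) r s := by
  open SuspensionMixing in
  have : CompactSpace X.carrier := isCompact_iff_compactSpace.mp X.isClosed.isCompact
  obtain ⟨c, hc0, hc⟩ := hW.exists_pos_le hpos
  obtain ⟨x₀⟩ : Nonempty X.carrier := by
    -- Over an empty shift the flow is vacuously mixing.
    by_contra hempty
    refine hmix fun U V _ hU _ _ => ?_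
    obtain ⟨p, -⟩ := hU
    obtain ⟨a, -⟩ := Quot.exists_rep p
    exact (hempty ⟨a.1.1⟩).elim
  -- The orbit periods have a common divisor that is smaller than the roof.
  obtain ⟨a, ha⟩ := (AddSubgroup.dense_or_cyclic _).resolve_left fun hd =>
    hmix (isTopologicallyMixing_of_dense hfin htrans hpos hW hd)
  obtain ⟨δ, hδ, hδc, hP⟩ : ∃ δ : ℝ, 0 < δ ∧ δ < c ∧
      ∀ τ ∈ orbitPeriods X r, (τ : AddCircle δ) = 0 := by
    have hmul : ∀ τ ∈ orbitPeriods X r, ∃ j : ℤ, j • a = τ := fun τ hτ =>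
      AddSubgroup.mem_closure_singleton.1 (ha ▸ AddSubgroup.subset_closure hτ)
    rcases eq_or_ne a 0 with rfl | ha0
    -- If all periods vanish, any `δ < c` serves.
    · refine ⟨c / 2, by positivity, by linarith, fun τ hτ => ?_⟩
      obtain ⟨j, rfl⟩ := hmul τ hτ
      simp
    · obtain ⟨q, hq⟩ := exists_nat_gt (|a| / c)
      have hq0 : (0 : ℝ) < q := lt_of_le_of_lt (by positivity) hq
      refine ⟨|a| / q, by positivity, ?_, fun τ hτ => ?_⟩
      · rw [div_lt_iff₀ hc0] at hq
        rw [div_lt_iff₀ hq0]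
        linarith
      · obtain ⟨j, rfl⟩ := hmul τ hτ
        rw [AddCircle.coe_eq_zero_iff]
        rcases abs_choice a with h | h
        · refine ⟨j * q, ?_⟩
          rw [h]
          simp only [zsmul_eq_mul]
          push_cast
          field_simp
        · refine ⟨-(j * q), ?_⟩
          rw [h]
          simp only [zsmul_eq_mul]
          push_cast
          field_simp
  have : Fact (0 < δ) := ⟨hδ⟩
  obtain ⟨g, hg, hgr⟩ := exists_continuous_circle_transfer hfin htrans hW x₀ hP
  obtain ⟨G, hG, hGg⟩ := exists_continuous_lift_addCircle hg
  have hint : ∀ x, ∃ m : ℤ, δ * m = r x - (G (leftShift X x) - G x) := by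
    intro x
    have : ((r x - (G (leftShift X x) - G x) : ℝ) : AddCircle δ) = 0 := by
      rw [AddCircle.coe_sub, AddCircle.coe_sub, hGg, hGg, hgr]
      abel
    obtain ⟨m, hm⟩ := (AddCircle.coe_eq_zero_iff δ).1 this
    exact ⟨m, by rw [← hm, zsmul_eq_mul, mul_comm]⟩
  choose m hm using hint
  have hshift := continuous_leftShift X
  have hmcont : Continuous m := by
    rw [Int.isClosedEmbedding_coe_real.isEmbedding.continuous_iff]
    have e : (Int.cast ∘ m : X.carrier → ℝ) = fun x => (r x - (G (leftShift X x) - G x)) / δ :=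
      funext fun x => by rw [← hm]; simp [hδ.ne']
    rw [e]
    exact (hW.continuous.sub ((hG.comp hshift).sub hG)).div_const δ
  -- Birkhoff sums of `δ m` differ from those of `r` by a bounded amount.
  obtain ⟨B, hB⟩ : ∃ B, ∀ x, |G x| ≤ B := by
    obtain ⟨B, hB⟩ := isCompact_univ.exists_bound_of_continuousOn hG.continuousOn
    exact ⟨B, fun x => hB x (Set.mem_univ x)⟩
  have hsum : ∀ n x, δ * (birkhoffSum (leftShift X) m n x : ℤ) =
      birkhoffSum (leftShift X) r n x - (G ((leftShift X)^[n] x) - G x) := by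
    intro n x
    induction n with
    | zero => simp
    | succ n ih =>
      rw [birkhoffSum_succ, birkhoffSum_succ, Int.cast_add, mul_add, ih, hm,
        Function.iterate_succ_apply']
      ring
  -- The sum of `δ m` over `N + 1` steps is at least `(N + 1) * c - 2 * B`, which for this `N`
  -- exceeds `(N + 1) * δ`.
  obtain ⟨N, hN⟩ := exists_nat_gt (2 * B / (c - δ))
  obtain ⟨u, hu, hpos'⟩ := exists_int_transfer_pos hshift hmcont (N := N) fun x => by
    have h1 := hsum (N + 1) x
    have h2 := le_birkhoffSum (f := leftShift X) hc (N + 1) x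
    have h3 := abs_le.1 (hB x)
    have h4 := abs_le.1 (hB ((leftShift X)^[N + 1] x))
    rw [div_lt_iff₀ (by linarith)] at hN
    have h5 : δ * ((N + 1 : ℤ) : ℝ) ≤ δ * (birkhoffSum (leftShift X) m (N + 1) x : ℤ) := by
      rw [h1]
      push_cast at h2 ⊢
      nlinarith
    have h6 := Int.cast_le.1 (le_of_mul_le_mul_left h5 hδ)
    exact sub_nonneg.2 h6
  refine ⟨δ, hδ, fun x => δ * (m x + u (leftShift X x) - u x : ℤ), ?_, fun x => ?_, fun x => ?_,
    fun x => G x - δ * u x, ?_, fun x => ?_⟩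
  · exact ((IsLocallyConstant.iff_continuous _).2
      ((hmcont.add (hu.comp hshift)).sub hu)).comp fun j : ℤ => δ * (j : ℝ)
  · have := hpos' x
    positivity
  · refine ⟨(m x + u (leftShift X x) - u x).toNat, ?_⟩
    rw [← Int.cast_natCast (R := ℝ), Int.toNat_of_nonneg (hpos' x).le]
  · exact hG.sub (continuous_const.mul (continuous_of_discreteTopology.comp hu))
  · have := hm x
    push_cast
    linarith
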